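/- For $k \ge 1$ let $f_k := (q^k;q^k)_\infty = \prod_{i\ge 1}(1-q^{ki})$, a formal power series in $q$ with integer coefficients, and let the integers $P^\ast(n)$, $n \ge 0$, be defined by \[ \sum_{n\ge 0} P^\ast(n)\,q^n = f_1^4 f_5^4 . \] Then for all integers $n \ge 0$ and $\alpha \ge 1$, \[ P^\ast\left(2^\alpha n + 2^\alpha - 1\right) \equiv 0 \pmod{2^{\alpha+1}} . \] -/

import Mathlib

open scoped PowerSeries.WithPiTopology

namespace ColorPartition

/-- The `q`-Pochhammer symbol `(a; q)_∞ = ∏_{i ≥ 0} (1 - a q^i)`, as an infinite product of formal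
power series over `ℤ` (in the topology of coefficientwise convergence, `ℤ` being discrete). -/
noncomputable def qPochhammerInf (a q : PowerSeries ℤ) : PowerSeries ℤ :=
  ∏' i : ℕ, (1 - a * q ^ i)

/-- `f_k = (q^k; q^k)_∞`, as a formal power series in `q = X` (meaningful for `k ≥ 1`). -/
noncomputable def f (k : ℕ) : PowerSeries ℤ :=
  qPochhammerInf (PowerSeries.X ^ k) (PowerSeries.X ^ k)

/-- `P*(n)`, defined by the generating function `∑_{n ≥ 0} P*(n) q^n = f_1^4 f_5^4`. -/
noncomputable def Pstar (n : ℕ) : ℤ :=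
  PowerSeries.coeff n (f 1 ^ 4 * f 5 ^ 4)

/-- The product defining `f_k` converges for `k ≥ 1`. -/
theorem multipliable_f {k : ℕ} (hk : 1 ≤ k) :
    Multipliable fun i : ℕ =>
      (1 : PowerSeries ℤ) - PowerSeries.X ^ k * (PowerSeries.X ^ k) ^ i := by
  simp_rw [sub_eq_add_neg]
  apply PowerSeries.WithPiTopology.multipliable_one_add_of_tendsto_order_atTop_nhds_top
  refine ENat.tendsto_nhds_top_iff_natCast_lt.mpr fun n => Filter.eventually_atTop.mpr ⟨n, ?_⟩
  intro m hm
  rw [PowerSeries.order_neg, ← pow_mul, ← pow_add, PowerSeries.order_X_pow, Nat.cast_lt]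
  nlinarith

end ColorPartition

/-! `Pstar n` is the coefficient of q^(n+1) in η(z)^4 η(5z)^4, a Hecke eigenform of weight 4 and
level 5 with T_2-eigenvalue -4. Hence P*(2n+1) = -4 P*(n) - 8 P*((n-1)/2), the last term being 0 for
even n (`Pstar_odd`), and the divisibility follows by a two-step induction. The Hecke relation is
proved by theta series alone. Gauss's product formulas (`f_mul_twoPsi`, `phiNeg_mul_f`) and
`phiNeg_sq` split f_1^4 f_5^4 into even and odd parts. With q^2 replaced by q, the odd part is -q
times f_1^2 f_5^2 (A^2 + B^2), where A - B = 2 f_1 f_5 (`two_mul_f_one_mul_f_five`) and AB is again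
an eta product. The identity for A - B comes from summing one theta series of u^2 + 5v^2 along two
different sublattice decompositions. -/

namespace ColorPartition

open PowerSeries Filter Topology

/-! ### Calculus of formal theta series -/

/-- The sum `∑ i, c i * X ^ e i` over an arbitrary index type. -/
noncomputable def theta {ι : Type*} (c : ι → ℤ) (e : ι → ℕ) : PowerSeries ℤ :=
  ∑' i, C (c i) * X ^ e i

/-- Only finitely many indices have exponent at most `n`. -/
def FinitelyMany {ι : Type*} (e : ι → ℕ) : Prop := ∀ n, {i | e i ≤ n}.Finite

section theta

variable {ι κ : Type*} {c : ι → ℤ} {e : ι → ℕ} {d : κ → ℤ} {g : κ → ℕ}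

theorem FinitelyMany.summable (he : FinitelyMany e) (c : ι → ℤ) :
    Summable fun i => (C (c i) * X ^ e i : PowerSeries ℤ) := by
  rw [PowerSeries.WithPiTopology.summable_iff_summable_coeff]
  intro n
  apply summable_of_hasFiniteSupport
  refine (he n).subset fun i hi => ?_
  simp only [Function.mem_support, coeff_C_mul, coeff_X_pow] at hi
  by_contra h
  simp only [Set.mem_ofPred_eq, not_le] at h
  simp [h.ne] at hi

theorem FinitelyMany.hasSum (he : FinitelyMany e) (c : ι → ℤ) :
    HasSum (fun i => (C (c i) * X ^ e i : PowerSeries ℤ)) (theta c e) :=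
  (he.summable c).hasSum

theorem FinitelyMany.prod_add (he : FinitelyMany e) (hg : FinitelyMany g) :
    FinitelyMany fun p : ι × κ => e p.1 + g p.2 := by
  intro n
  refine ((he n).prod (hg n)).subset fun p hp => ?_
  simp only [Set.mem_ofPred_eq, Set.mem_prod] at hp ⊢
  omega

theorem FinitelyMany.mul_left (he : FinitelyMany e) {k : ℕ} (hk : k ≠ 0) :
    FinitelyMany fun i => k * e i := by
  intro n
  refine (he n).subset fun i hi => ?_
  simp only [Set.mem_ofPred_eq] at hi ⊢
  exact (Nat.le_mul_of_pos_left _ (Nat.pos_of_ne_zero hk)).trans hi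

theorem theta_mul (he : FinitelyMany e) (hg : FinitelyMany g) (c : ι → ℤ) (d : κ → ℤ) :
    theta c e * theta d g = theta (fun p : ι × κ => c p.1 * d p.2) fun p => e p.1 + g p.2 := by
  have h : ∀ p : ι × κ, (C (c p.1) * X ^ e p.1 * (C (d p.2) * X ^ g p.2) : PowerSeries ℤ) =
      C (c p.1 * d p.2) * X ^ (e p.1 + g p.2) := fun p => by
    rw [map_mul, pow_add]; ring
  have := (he.hasSum c).mul (hg.hasSum d) (by simpa only [h] using (he.prod_add hg).summable _)
  simp only [h] at this
  exact this.tsum_eq.symm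

theorem theta_add (he : FinitelyMany e) (c c' : ι → ℤ) :
    theta (fun i => c i + c' i) e = theta c e + theta c' e := by
  have := (he.hasSum c).add (he.hasSum c')
  simp only [← add_mul, ← map_add] at this
  exact this.tsum_eq

theorem theta_neg : theta (fun i => -c i) e = -theta c e := by
  simp [theta, tsum_neg]

theorem X_pow_mul_theta (he : FinitelyMany e) (m : ℕ) :
    X ^ m * theta c e = theta c fun i => m + e i := by
  have := (he.hasSum c).mul_left (X ^ m)
  refine this.tsum_eq.symm.trans (tsum_congr fun i => ?_)
  rw [pow_add]; ring

/-- The workhorse for changes of lattice coordinates: a residue condition sits in the coefficients,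
and σ parametrises the sublattice it cuts out. -/
theorem theta_comp_injective {σ : κ → ι} (hσ : σ.Injective)
    (hc : ∀ i, c i ≠ 0 → i ∈ Set.range σ)
    (hd : ∀ j, c (σ j) = d j) (hg : ∀ j, e (σ j) = g j) : theta c e = theta d g := by
  rw [theta, ← hσ.tsum_eq]
  · simp [theta, hd, hg]
  · intro i hi
    refine hc i fun h => ?_
    simp [h] at hi

theorem theta_reindex (σ : κ ≃ ι) (hd : ∀ j, c (σ j) = d j) (hg : ∀ j, e (σ j) = g j) :
    theta c e = theta d g :=
  theta_comp_injective σ.injective (fun i _ => σ.surjective i) hd hg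

theorem continuous_expand {p : ℕ} (hp : p ≠ 0) :
    Continuous (PowerSeries.expand p hp : PowerSeries ℤ → PowerSeries ℤ) := by
  rw [continuous_iff_continuousAt]
  intro x
  rw [ContinuousAt, PowerSeries.WithPiTopology.tendsto_iff_coeff_tendsto]
  intro n
  simp only [coeff_expand]
  split_ifs
  · exact (PowerSeries.WithPiTopology.continuous_coeff ℤ _).continuousAt
  · exact tendsto_const_nhds

theorem expand_theta (he : FinitelyMany e) {p : ℕ} (hp : p ≠ 0) :
    expand p hp (theta c e) = theta c fun i => p * e i := by
  have := (he.hasSum c).map (expand p hp) (continuous_expand hp)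
  refine this.tsum_eq.symm.trans (tsum_congr fun i => ?_)
  simp [pow_mul]

end theta

/-! ### The classical theta functions and Euler's pentagonal series -/

/-- The triangular number `n (n + 1) / 2`. -/
def tri (n : ℤ) : ℕ := (n * (n + 1) / 2).toNat

theorem two_mul_tri (n : ℤ) : 2 * (tri n : ℤ) = n * (n + 1) := by
  have h : 2 * (n * (n + 1) / 2) = n * (n + 1) :=
    Int.two_mul_ediv_two_of_even (Int.even_mul_succ_self n)
  have h0 : 0 ≤ n * (n + 1) := by
    rcases le_or_gt 0 n with h | h <;> nlinarith
  rw [tri, Int.toNat_of_nonneg (by omega), h]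

theorem finite_of_natAbs_le {e : ℤ → ℕ} (h : ∀ n, n.natAbs ≤ e n + 1) : FinitelyMany e := by
  intro N
  refine (Set.finite_Icc (-(N + 1 : ℤ)) (N + 1)).subset fun i hi => ?_
  have := h i
  simp only [Set.mem_ofPred_eq, Set.mem_Icc] at hi ⊢
  omega

theorem finitelyMany_tri : FinitelyMany tri := by
  refine finite_of_natAbs_le fun n => ?_
  have := two_mul_tri n
  zify
  rcases abs_cases n with h | h <;> rw [h.1] <;> nlinarith

theorem finitelyMany_sq : FinitelyMany fun n : ℤ => n.natAbs ^ 2 := by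
  refine finite_of_natAbs_le fun n => ?_
  nlinarith

theorem finitelyMany_pentagonal : FinitelyMany pentagonal := by
  refine finite_of_natAbs_le fun n => ?_
  have := two_mul_natCast_pentagonal n
  zify
  rcases abs_cases n with h | h <;> rw [h.1] <;> nlinarith

/-- `φ(q^k) = ∑ n ∈ ℤ, q^(k n²)`. -/
noncomputable def phi (k : ℕ) : PowerSeries ℤ := theta (fun _ : ℤ => 1) fun n => k * n.natAbs ^ 2

/-- `φ(-q^k) = ∑ n ∈ ℤ, (-1)^n q^(k n²)`, for the substitution `q^k ↦ -q^k`. -/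
noncomputable def phiNeg (k : ℕ) : PowerSeries ℤ :=
  theta (fun n : ℤ => (n.negOnePow : ℤ)) fun n => k * n.natAbs ^ 2

/-- `2 ψ(q^k) = ∑ n ∈ ℤ, q^(k n (n + 1) / 2)`. -/
noncomputable def twoPsi (k : ℕ) : PowerSeries ℤ := theta (fun _ : ℤ => 1) fun n => k * tri n

theorem expand_phi {k p : ℕ} (hk : k ≠ 0) (hp : p ≠ 0) : expand p hp (phi k) = phi (p * k) := by
  simp [phi, expand_theta (finitelyMany_sq.mul_left hk), mul_assoc]

theorem expand_twoPsi {k p : ℕ} (hk : k ≠ 0) (hp : p ≠ 0) :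
    expand p hp (twoPsi k) = twoPsi (p * k) := by
  simp [twoPsi, expand_theta (finitelyMany_tri.mul_left hk), mul_assoc]

theorem hasProd_f {k : ℕ} (hk : k ≠ 0) :
    HasProd (fun i => 1 - (X ^ k : PowerSeries ℤ) ^ (i + 1)) (f k) := by
  have := (multipliable_f (Nat.one_le_iff_ne_zero.mpr hk)).hasProd
  simpa only [f, qPochhammerInf, ← pow_succ'] using this

theorem expand_f {k p : ℕ} (hk : k ≠ 0) (hp : p ≠ 0) : expand p hp (f k) = f (p * k) := by
  have := (hasProd_f hk).map (expand p hp) (continuous_expand hp)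
  refine this.unique ?_
  convert hasProd_f (mul_ne_zero hp hk) using 2 with i
  simp [pow_mul]

theorem f_eq_theta {k : ℕ} (hk : k ≠ 0) :
    f k = theta (fun n : ℤ => (n.negOnePow : ℤ)) fun n => k * pentagonal n := by
  have h : f 1 = theta (fun n : ℤ => (n.negOnePow : ℤ)) pentagonal := by
    have h₁ := hasProd_f one_ne_zero
    simp only [pow_one] at h₁
    rw [h₁.unique (PowerSeries.WithPiTopology.hasProd_one_sub_X_pow ℤ),
      PowerSeries.WithPiTopology.pentagonalSeries_eq_tsum, theta]
    simp
  rw [← mul_one k, ← expand_f one_ne_zero hk, h, expand_theta finitelyMany_pentagonal, mul_one]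

/-! ### Parity dissections of squares of theta functions -/

/-- The indicator of `i % m = r`. -/
def residue (m r i : ℤ) : ℤ := if i % m = r then 1 else 0

theorem sq_natAbs (n : ℤ) : ((n.natAbs ^ 2 : ℕ) : ℤ) = n ^ 2 := by simp

theorem theta_split_residue_two {ι : Type*} {e : ι → ℕ} (he : FinitelyMany e) (c : ι → ℤ)
    (s : ι → ℤ) : theta c e =
      theta (fun i => residue 2 0 (s i) * c i) e + theta (fun i => residue 2 1 (s i) * c i) e := by
  rw [← theta_add he]
  congr 1
  funext i
  rcases Int.emod_two_eq_zero_or_one (s i) with h | h <;> simp [residue, h]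

theorem theta_split_residue_three {ι : Type*} {e : ι → ℕ} (he : FinitelyMany e) (c : ι → ℤ)
    (s : ι → ℤ) : theta c e =
      theta (fun i => residue 3 0 (s i) * c i) e + theta (fun i => residue 3 1 (s i) * c i) e +
        theta (fun i => residue 3 2 (s i) * c i) e := by
  rw [← theta_add he, ← theta_add he]
  congr 1
  funext i
  have h : s i % 3 = 0 ∨ s i % 3 = 1 ∨ s i % 3 = 2 := by omega
  rcases h with h | h | h <;> simp [residue, h]

theorem residue_ne_zero {m r i : ℤ} {x : ℤ} (h : residue m r i * x ≠ 0) : i % m = r := by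
  by_contra h'
  simp [residue, h'] at h

theorem tri_neg (a : ℤ) : tri (-1 - a) = tri a := by
  have h₁ := two_mul_tri a
  have h₂ := two_mul_tri (-1 - a)
  zify
  linarith

/-- Split pairs (a, b) by the parity of a + b. The reflection a ↦ -1 - a swaps the classes, whence
the 2; on the even class, a = m + n and b = n - m separate the variables. -/
theorem twoPsi_sq {k : ℕ} (hk : k ≠ 0) : twoPsi k ^ 2 = 2 * phi k * twoPsi (2 * k) := by
  have ht := finitelyMany_tri.mul_left hk
  have hs := finitelyMany_sq.mul_left hk
  have ht' := finitelyMany_tri.mul_left (mul_ne_zero two_ne_zero hk)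
  rw [sq, twoPsi, theta_mul ht ht, theta_split_residue_two (ht.prod_add ht) _ fun p => p.1 + p.2]
  have hodd : theta (fun p : ℤ × ℤ => residue 2 1 (p.1 + p.2) * (1 * 1))
      (fun p => k * tri p.1 + k * tri p.2) =
      theta (fun p : ℤ × ℤ => residue 2 0 (p.1 + p.2) * (1 * 1))
      (fun p => k * tri p.1 + k * tri p.2) := by
    refine theta_reindex ((Equiv.subLeft (-1)).prodCongr (Equiv.refl ℤ)) ?_ ?_
    · rintro ⟨a, b⟩
      simp only [Equiv.prodCongr_apply, Prod.map_apply, Equiv.subLeft_apply, Equiv.refl_apply,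
        residue]
      split_ifs <;> first | rfl | omega
    · rintro ⟨a, b⟩
      simp [tri_neg]
  have heven : theta (fun p : ℤ × ℤ => residue 2 0 (p.1 + p.2) * (1 * 1))
      (fun p => k * tri p.1 + k * tri p.2) = phi k * twoPsi (2 * k) := by
    rw [phi, twoPsi, theta_mul hs ht']
    refine theta_comp_injective (σ := fun p : ℤ × ℤ => (p.1 + p.2, p.2 - p.1)) ?_ ?_ ?_ ?_
    · rintro ⟨a, b⟩ ⟨c, d⟩ h
      simp only [Prod.mk.injEq] at h ⊢
      omega
    · rintro ⟨a, b⟩ h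
      have := residue_ne_zero h
      refine ⟨((a - b) / 2, (a + b) / 2), ?_⟩
      simp only [Prod.mk.injEq] at this ⊢
      omega
    · rintro ⟨m, n⟩
      have : (m + n + (n - m)) % 2 = 0 := by omega
      simp [residue, this]
    · rintro ⟨m, n⟩
      have h₁ := two_mul_tri (m + n)
      have h₂ := two_mul_tri (n - m)
      have h₃ := two_mul_tri n
      have h₄ := sq_natAbs m
      have : tri (m + n) + tri (n - m) = m.natAbs ^ 2 + 2 * tri n := by
        zify at *
        linarith
      simp only [← mul_add, this]
      ring
  rw [hodd, heven]
  ring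

theorem phiNeg_sq {k : ℕ} (hk : k ≠ 0) :
    phiNeg k ^ 2 = phi (2 * k) ^ 2 - X ^ k * twoPsi (4 * k) ^ 2 := by
  have hs := finitelyMany_sq.mul_left hk
  have hs' := finitelyMany_sq.mul_left (mul_ne_zero two_ne_zero hk)
  have ht := finitelyMany_tri.mul_left (mul_ne_zero four_ne_zero hk)
  rw [sq, phiNeg, theta_mul hs hs, theta_split_residue_two (hs.prod_add hs) _ fun p => p.1 + p.2,
    sub_eq_add_neg]
  congr 1
  · rw [sq, phi, theta_mul hs' hs']
    refine theta_comp_injective (σ := fun p : ℤ × ℤ => (p.1 + p.2, p.1 - p.2)) ?_ ?_ ?_ ?_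
    · rintro ⟨a, b⟩ ⟨c, d⟩ h
      simp only [Prod.mk.injEq] at h ⊢
      omega
    · rintro ⟨a, b⟩ h
      have := residue_ne_zero h
      refine ⟨((a + b) / 2, (a - b) / 2), ?_⟩
      simp only [Prod.mk.injEq] at this ⊢
      omega
    · rintro ⟨m, n⟩
      have : (m + n + (m - n)) % 2 = 0 := by omega
      rw [residue, if_pos this, ← Units.val_mul, ← Int.negOnePow_add, Int.negOnePow_even]
      · simp
      · rw [Int.even_iff]
        exact this
    · rintro ⟨m, n⟩
      have : (m + n).natAbs ^ 2 + (m - n).natAbs ^ 2 = 2 * (m.natAbs ^ 2 + n.natAbs ^ 2) := by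
        zify
        simp only [sq_abs]
        ring
      simp only [← mul_add, this]
      ring
  · rw [sq, twoPsi, theta_mul ht ht, X_pow_mul_theta (ht.prod_add ht), ← theta_neg]
    refine theta_comp_injective (σ := fun p : ℤ × ℤ => (p.1 + p.2 + 1, p.1 - p.2)) ?_ ?_ ?_ ?_
    · rintro ⟨a, b⟩ ⟨c, d⟩ h
      simp only [Prod.mk.injEq] at h ⊢
      omega
    · rintro ⟨a, b⟩ h
      have := residue_ne_zero h
      refine ⟨((a + b - 1) / 2, (a - b - 1) / 2), ?_⟩
      simp only [Prod.mk.injEq] at this ⊢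
      omega
    · rintro ⟨m, n⟩
      have : (m + n + 1 + (m - n)) % 2 = 1 := by omega
      rw [residue, if_pos this, ← Units.val_mul, ← Int.negOnePow_add, Int.negOnePow_odd]
      · simp
      · rw [Int.odd_iff]
        exact this
    · rintro ⟨m, n⟩
      have h₁ := two_mul_tri m
      have h₂ := two_mul_tri n
      have : (m + n + 1).natAbs ^ 2 + (m - n).natAbs ^ 2 = 1 + 4 * (tri m + tri n) := by
        zify
        simp only [sq_abs]
        linarith
      simp only [← mul_add, this]
      ring

/-! ### The form u² + 5v² and the product f₁f₅ -/

/-- The quadratic polynomial `(u² + 5 v² - 1) / 4` in terms of `v` and `w = (u + v - 1) / 2`. -/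
def quadExp (p : ℤ × ℤ) : ℕ := (p.1 * (p.1 + 1) - p.1 * p.2 + pentagonal p.2).toNat

theorem two_mul_quadExp (w v : ℤ) :
    2 * (quadExp (w, v) : ℤ) = 2 * w * (w + 1) - 2 * w * v + v * (3 * v - 1) := by
  have h := two_mul_natCast_pentagonal v
  have h0 : 0 ≤ w * (w + 1) - w * v + pentagonal v := by
    by_contra! hneg
    -- The left side is u² + 5v² - 1 with u = 2w + 1 - v, so it is at least -1.
    have : 4 * (w * (w + 1) - w * v + pentagonal v) ≤ -4 := by omega
    nlinarith [sq_nonneg (2 * w + 1 - v), sq_nonneg v]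
  rw [quadExp, Int.toNat_of_nonneg h0]
  linarith

theorem finitelyMany_quadExp : FinitelyMany quadExp := by
  intro N
  refine (((Set.finite_Icc (-(2 * N + 1 : ℤ)) (2 * N + 1)).prod
    (Set.finite_Icc (-(2 * N + 1 : ℤ)) (2 * N + 1)))).subset fun ⟨w, v⟩ hp => ?_
  have h := two_mul_quadExp w v
  simp only [Set.mem_ofPred_eq, Set.mem_prod, Set.mem_Icc] at hp ⊢
  have hp' : (quadExp (w, v) : ℤ) ≤ N := by exact_mod_cast hp
  have hv : v ^ 2 ≤ 4 * N + 1 := by nlinarith [sq_nonneg (2 * w + 1 - v)]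
  have hw : 20 * w ^ 2 + 20 * w ≤ 24 * N + 1 := by nlinarith [sq_nonneg (6 * v - (2 * w + 1))]
  refine ⟨⟨?_, ?_⟩, ?_, ?_⟩ <;> nlinarith

/-- Split by the parity of v: u has the opposite parity, so (u, v) is (2n + 1, 2m) or (2m, 2n + 1),
and the exponent has no cross term. -/
theorem theta_quadExp_eq : theta (fun p : ℤ × ℤ => (p.2.negOnePow : ℤ)) quadExp =
    twoPsi 2 * phi 5 - X * phi 1 * twoPsi 10 := by
  have ht2 := finitelyMany_tri.mul_left two_ne_zero
  have ht10 := finitelyMany_tri.mul_left (k := 10) (by norm_num)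
  have hs1 := finitelyMany_sq.mul_left one_ne_zero
  have hs5 := finitelyMany_sq.mul_left (k := 5) (by norm_num)
  rw [theta_split_residue_two finitelyMany_quadExp _ fun p => p.2, sub_eq_add_neg]
  congr 1
  · rw [twoPsi, phi, theta_mul ht2 hs5]
    refine theta_comp_injective (σ := fun p : ℤ × ℤ => (p.1 + p.2, 2 * p.2)) ?_ ?_ ?_ ?_
    · rintro ⟨a, b⟩ ⟨c, d⟩ h
      simp only [Prod.mk.injEq] at h ⊢
      omega
    · rintro ⟨a, b⟩ h
      have := residue_ne_zero h
      refine ⟨(a - b / 2, b / 2), ?_⟩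
      simp only [Prod.mk.injEq] at this ⊢
      omega
    · rintro ⟨n, m⟩
      simp [residue]
    · rintro ⟨n, m⟩
      have h₁ := two_mul_quadExp (n + m) (2 * m)
      have h₂ := two_mul_tri n
      zify
      simp only [sq_abs]
      linarith
  · rw [mul_assoc, twoPsi, phi, theta_mul hs1 ht10, ← pow_one X, X_pow_mul_theta (hs1.prod_add ht10),
      ← theta_neg]
    refine theta_comp_injective (σ := fun p : ℤ × ℤ => (p.1 + p.2, 2 * p.2 + 1)) ?_ ?_ ?_ ?_
    · rintro ⟨a, b⟩ ⟨c, d⟩ h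
      simp only [Prod.mk.injEq] at h ⊢
      omega
    · rintro ⟨a, b⟩ h
      have := residue_ne_zero h
      refine ⟨(a - b / 2, b / 2), ?_⟩
      simp only [Prod.mk.injEq] at this ⊢
      omega
    · rintro ⟨m, n⟩
      have : (2 * n + 1) % 2 = 1 := by omega
      simp [residue, this, Int.negOnePow_succ]
    · rintro ⟨m, n⟩
      have h₁ := two_mul_quadExp (m + n) (2 * n + 1)
      have h₂ := two_mul_tri n
      zify
      simp only [sq_abs]
      linarith

/-- The substitution w = 3b - 1, v = b - a diagonalises the exponent into two pentagonal numbers,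
the second with weight 5. -/
theorem theta_quadExp_residue_two :
    theta (fun p : ℤ × ℤ => residue 3 2 p.1 * (p.2.negOnePow : ℤ)) quadExp = f 1 * f 5 := by
  have h1 := finitelyMany_pentagonal.mul_left one_ne_zero
  have h5 := finitelyMany_pentagonal.mul_left (k := 5) (by norm_num)
  rw [f_eq_theta one_ne_zero, f_eq_theta (k := 5) (by norm_num), theta_mul h1 h5]
  refine theta_comp_injective (σ := fun p : ℤ × ℤ => (3 * p.2 - 1, p.2 - p.1)) ?_ ?_ ?_ ?_
  · rintro ⟨a, b⟩ ⟨c, d⟩ h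
    simp only [Prod.mk.injEq] at h ⊢
    omega
  · rintro ⟨w, v⟩ h
    have := residue_ne_zero h
    refine ⟨((w + 1) / 3 - v, (w + 1) / 3), ?_⟩
    simp only [Prod.mk.injEq] at this ⊢
    omega
  · rintro ⟨a, b⟩
    simp [residue, Int.negOnePow_sub, mul_comm]
  · rintro ⟨a, b⟩
    have h₁ := two_mul_quadExp (3 * b - 1) (b - a)
    have h₂ := two_mul_natCast_pentagonal a
    have h₃ := two_mul_natCast_pentagonal b
    zify
    linarith

/-- The symmetry (u, v) ↦ (-u, -v) sends w to -1 - w, swapping the classes 0 and 2 mod 3. -/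
theorem theta_quadExp_residue_zero :
    theta (fun p : ℤ × ℤ => residue 3 0 p.1 * (p.2.negOnePow : ℤ)) quadExp =
      theta (fun p : ℤ × ℤ => residue 3 2 p.1 * (p.2.negOnePow : ℤ)) quadExp := by
  refine theta_reindex ((Equiv.subLeft (-1)).prodCongr (Equiv.neg ℤ)) ?_ ?_
  · rintro ⟨w, v⟩
    simp only [Equiv.prodCongr_apply, Prod.map_apply, Equiv.subLeft_apply, Equiv.neg_apply,
      Int.negOnePow_neg, residue]
    congr 1
    split_ifs <;> first | rfl | omega
  · rintro ⟨w, v⟩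
    have h₁ := two_mul_quadExp w v
    have h₂ := two_mul_quadExp (-1 - w) (-v)
    simp only [Equiv.prodCongr_apply, Prod.map_apply, Equiv.subLeft_apply, Equiv.neg_apply]
    zify
    linarith

theorem eq_zero_of_eq_neg {p : PowerSeries ℤ} (h : p = -p) : p = 0 := by
  ext n
  have := congrArg (coeff n) h
  rw [map_neg] at this
  rw [map_zero]
  omega

/-- For fixed w the exponent is quadratic in v with axis (2w + 1)/6. When w = 3t + 1, reflection in
the axis is the integral map v ↦ 2t + 1 - v, which flips the sign (-1)^v. -/
theorem theta_quadExp_residue_one :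
    theta (fun p : ℤ × ℤ => residue 3 1 p.1 * (p.2.negOnePow : ℤ)) quadExp = 0 := by
  have h : theta (fun p : ℤ × ℤ => residue 3 1 p.1 * (p.2.negOnePow : ℤ)) quadExp =
      theta (fun p : ℤ × ℤ => (p.2.negOnePow : ℤ)) fun p => quadExp (3 * p.1 + 1, p.2) := by
    refine theta_comp_injective (σ := fun p : ℤ × ℤ => (3 * p.1 + 1, p.2)) ?_ ?_ ?_ fun _ => rfl
    · rintro ⟨a, b⟩ ⟨c, d⟩ h
      simp only [Prod.mk.injEq] at h ⊢
      omega
    · rintro ⟨w, v⟩ h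
      have := residue_ne_zero h
      refine ⟨(w / 3, v), Prod.ext ?_ rfl⟩
      dsimp only at this ⊢
      omega
    · rintro ⟨t, v⟩
      have : (3 * t + 1) % 3 = 1 := by omega
      simp [residue, this]
  have hinv : Function.Involutive fun p : ℤ × ℤ => (p.1, 2 * p.1 + 1 - p.2) := by
    rintro ⟨t, v⟩
    simp
  rw [h]
  apply eq_zero_of_eq_neg
  rw [← theta_neg]
  refine theta_reindex hinv.toPerm ?_ ?_
  · rintro ⟨t, v⟩
    have : (2 * t + 1 - v).negOnePow = -v.negOnePow := by
      rw [add_sub_right_comm, Int.negOnePow_succ, Int.negOnePow_sub,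
        Int.negOnePow_even _ (even_two_mul _), one_mul]
    simp [this]
  · rintro ⟨t, v⟩
    have h₁ := two_mul_quadExp (3 * t + 1) v
    have h₂ := two_mul_quadExp (3 * t + 1) (2 * t + 1 - v)
    simp only [Function.Involutive.coe_toPerm]
    zify
    linarith

theorem two_mul_f_one_mul_f_five :
    2 * (f 1 * f 5) = twoPsi 2 * phi 5 - X * phi 1 * twoPsi 10 := by
  rw [← theta_quadExp_eq, theta_split_residue_three finitelyMany_quadExp _ fun p => p.1,
    theta_quadExp_residue_zero, theta_quadExp_residue_one, theta_quadExp_residue_two]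
  ring

/-! ### Finite forms of Gauss's identities -/

section Finite

open Finset

variable {R : Type*} [CommRing R]

/-- Shanks's finite form of Gauss's identity for `∑ q^(j (j + 1) / 2)`. -/
theorem prod_mul_sum_pow_tri (q : R) (n : ℕ) :
    (∏ i ∈ range n, (1 - q ^ (2 * i + 1))) * ∑ j ∈ range (2 * n), q ^ tri j =
      ∑ s ∈ range n, (∏ i ∈ Ico s n, (1 - q ^ (2 * i + 2))) *
        (∏ i ∈ range s, (1 - q ^ (2 * i + 1))) * q ^ (s * (2 * n + 1)) := by
  induction n with
  | zero => simp
  | succ n ih =>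
    -- Compares levels n + 1 and n up to a boundary term. At m = n that term and the summand s = n
    -- combine into the contribution of the two new triangular exponents.
    have tele : ∀ m ≤ n, ∑ s ∈ range m, (∏ i ∈ Ico s (n + 1), (1 - q ^ (2 * i + 2))) *
        (∏ i ∈ range s, (1 - q ^ (2 * i + 1))) * q ^ (s * (2 * (n + 1) + 1)) =
        (1 - q ^ (2 * n + 1)) * ∑ s ∈ range m, (∏ i ∈ Ico s n, (1 - q ^ (2 * i + 2))) *
          (∏ i ∈ range s, (1 - q ^ (2 * i + 1))) * q ^ (s * (2 * n + 1)) +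
        (∏ i ∈ Ico m n, (1 - q ^ (2 * i + 2))) * (∏ i ∈ range m, (1 - q ^ (2 * i + 1))) *
          (1 - q ^ (2 * m)) * q ^ (m * (2 * n + 1)) := by
      intro m hm
      induction m with
      | zero => simp
      | succ m ihm =>
        rw [sum_range_succ, sum_range_succ, ihm (by omega), prod_Ico_succ_top (by omega : m ≤ n),
          prod_eq_prod_Ico_succ_bot (by omega : m < n), prod_range_succ]
        ring
    have h₁ : tri (2 * n : ℕ) = n * (2 * n + 1) := by
      have := two_mul_tri (2 * n : ℕ)
      zify
      push_cast at this
      linarith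
    have h₂ : tri (2 * n + 1 : ℕ) = n * (2 * n + 1) + (2 * n + 1) := by
      have := two_mul_tri (2 * n + 1 : ℕ)
      zify
      push_cast at this
      linarith
    rw [sum_range_succ _ n, tele n le_rfl, ← ih, prod_range_succ, mul_add 2 n 1, mul_one,
      sum_range_succ, sum_range_succ, h₁, h₂]
    simp
    ring

/-- Shanks's finite form of Gauss's identity for `∑ (-1)^j q^(j^2)`. -/
theorem prod_mul_sum_pow_sq (q : R) (n : ℕ) :
    (∏ i ∈ range n, (1 + q ^ (i + 1))) *
        (1 + 2 * ∑ j ∈ range n, (-1) ^ (j + 1) * q ^ ((j + 1) ^ 2)) =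
      ∏ i ∈ range n, (1 - q ^ (i + 1)) +
        ∑ s ∈ range n, 2 * (-1) ^ (s + 1) * (∏ i ∈ Ico (s + 1) n, (1 - q ^ (i + 1))) *
          (∏ i ∈ range s, (1 + q ^ (i + 1))) * q ^ ((s + 1) * (n + 1)) := by
  induction n with
  | zero => simp
  | succ n ih =>
    -- As before; here the boundary term and the summand s = n yield the new square exponent (n +
    -- 1)².
    have tele : ∀ m ≤ n, ∏ i ∈ range (n + 1), (1 - q ^ (i + 1)) +
        ∑ s ∈ range m, 2 * (-1) ^ (s + 1) * (∏ i ∈ Ico (s + 1) (n + 1), (1 - q ^ (i + 1))) *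
          (∏ i ∈ range s, (1 + q ^ (i + 1))) * q ^ ((s + 1) * (n + 2)) =
        (1 + q ^ (n + 1)) * (∏ i ∈ range n, (1 - q ^ (i + 1)) +
          ∑ s ∈ range m, 2 * (-1) ^ (s + 1) * (∏ i ∈ Ico (s + 1) n, (1 - q ^ (i + 1))) *
          (∏ i ∈ range s, (1 + q ^ (i + 1))) * q ^ ((s + 1) * (n + 1))) +
        2 * (-1) ^ (m + 1) * (∏ i ∈ Ico m n, (1 - q ^ (i + 1))) *
          (∏ i ∈ range m, (1 + q ^ (i + 1))) * q ^ ((m + 1) * (n + 1)) := by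
      intro m hm
      induction m with
      | zero =>
        simp [prod_range_succ]
        ring
      | succ m ihm =>
        rw [sum_range_succ, sum_range_succ, ← add_assoc, ihm (by omega),
          prod_Ico_succ_top (by omega : m + 1 ≤ n),
          prod_eq_prod_Ico_succ_bot (by omega : m < n), prod_range_succ]
        ring
    rw [sum_range_succ _ n, prod_range_succ, sum_range_succ _ n, ← add_assoc]
    simp only [add_assoc n 1 1, one_add_one_eq_two]
    rw [tele n le_rfl, ← ih]
    simp
    ring

end Finite

/-! ### Passage to the limit: Gauss's product formulas -/

theorem tendsto_zero_of_X_pow_dvd {r : ℕ → PowerSeries ℤ} (h : ∀ n, X ^ n ∣ r n) :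
    Tendsto r atTop (𝓝 0) := by
  rw [PowerSeries.WithPiTopology.tendsto_iff_coeff_tendsto]
  intro d
  refine tendsto_atTop_of_eventually_const (i₀ := d + 1) fun n hn => ?_
  rw [map_zero]
  exact X_pow_dvd_iff.mp (h n) d hn

theorem multipliable_one_add_C_mul_X_pow (c : ℤ) {g : ℕ → ℕ} (hg : ∀ i, i ≤ g i) :
    Multipliable fun i => (1 + C c * X ^ g i : PowerSeries ℤ) := by
  apply PowerSeries.WithPiTopology.multipliable_one_add_of_tendsto_order_atTop_nhds_top
  refine ENat.tendsto_nhds_top_iff_natCast_lt.mpr fun n => eventually_atTop.mpr ⟨n + 1, ?_⟩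
  intro m hm
  grw [← le_order_mul, order_X_pow]
  refine lt_add_of_nonneg_of_lt (by simp) ?_
  exact_mod_cast hm.trans (hg m)

theorem multipliable_one_sub_odd {k : ℕ} (hk : k ≠ 0) :
    Multipliable fun i => (1 - (X ^ k) ^ (2 * i + 1) : PowerSeries ℤ) := by
  have := multipliable_one_add_C_mul_X_pow (-1) (g := fun i => k * (2 * i + 1)) fun i => by
    have := Nat.pos_of_ne_zero hk
    nlinarith
  simpa [← pow_mul, sub_eq_add_neg] using this

theorem multipliable_one_add {k : ℕ} (hk : k ≠ 0) :
    Multipliable fun i => (1 + (X ^ k) ^ (i + 1) : PowerSeries ℤ) := by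
  have := multipliable_one_add_C_mul_X_pow 1 (g := fun i => k * (i + 1)) fun i => by
    have := Nat.pos_of_ne_zero hk
    nlinarith
  simpa [← pow_mul] using this

theorem tprod_one_sub_odd_mul_f {k : ℕ} (hk : k ≠ 0) :
    (∏' i, (1 - (X ^ k) ^ (2 * i + 1) : PowerSeries ℤ)) * f (2 * k) = f k := by
  have h₁ := (multipliable_one_sub_odd hk).hasProd
  have h₂ := hasProd_f (mul_ne_zero two_ne_zero hk)
  refine HasProd.unique (HasProd.even_mul_odd (f := fun i => 1 - (X ^ k : PowerSeries ℤ) ^ (i + 1))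
    h₁ ?_) (hasProd_f hk)
  convert h₂ using 2 with i
  ring

theorem tprod_one_add_mul_f {k : ℕ} (hk : k ≠ 0) :
    (∏' i, (1 + (X ^ k) ^ (i + 1) : PowerSeries ℤ)) * f k = f (2 * k) := by
  refine ((multipliable_one_add hk).hasProd.mul (hasProd_f hk)).unique ?_
  convert hasProd_f (mul_ne_zero two_ne_zero hk) using 2 with i
  ring

theorem hasSum_twoPsi {k : ℕ} (hk : k ≠ 0) :
    HasSum (fun j : ℕ => 2 * (X ^ k : PowerSeries ℤ) ^ tri j) (twoPsi k) := by
  have h : HasSum _ (twoPsi k) :=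
    ((finitelyMany_tri.mul_left hk).hasSum fun _ => 1).nat_add_neg_add_one
  convert h using 2 with j
  rw [show -((j : ℤ) + 1) = -1 - j by ring, tri_neg, ← pow_mul, map_one]
  ring

theorem tendsto_phiNeg {k : ℕ} (hk : k ≠ 0) :
    Tendsto (fun n => 1 + 2 * ∑ j ∈ Finset.range n,
      (-1) ^ (j + 1) * (X ^ k : PowerSeries ℤ) ^ ((j + 1) ^ 2)) atTop (𝓝 (phiNeg k)) := by
  have h := ((finitelyMany_sq.mul_left hk).hasSum
    fun n : ℤ => (n.negOnePow : ℤ)).nat_add_neg.tendsto_sum_nat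
  have h' := (h.comp (tendsto_add_atTop_nat 1)).sub_const 1
  convert h' using 2 with n
  · simp only [Function.comp_apply, Finset.sum_range_succ', Finset.mul_sum]
    have h₁ (x : ℕ) : ((x : ℤ) + 1).natAbs = x + 1 := by omega
    have h₂ (x : ℕ) : (-1 + -(x : ℤ)).natAbs = x + 1 := by omega
    simp [← pow_mul, Int.coe_negOnePow, h₁, h₂, ← two_mul]
    ring
  · simp [phiNeg]

theorem f_mul_twoPsi {k : ℕ} (hk : k ≠ 0) : f k * twoPsi k = 2 * f (2 * k) ^ 2 := by
  have h₁ : Tendsto (fun n => (∏ i ∈ Finset.range n, (1 - (X ^ k : PowerSeries ℤ) ^ (2 * i + 1))) *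
      ∑ j ∈ Finset.range (2 * n), 2 * (X ^ k : PowerSeries ℤ) ^ tri j) atTop
      (𝓝 ((∏' i, (1 - (X ^ k) ^ (2 * i + 1) : PowerSeries ℤ)) * twoPsi k)) :=
    (multipliable_one_sub_odd hk).hasProd.tendsto_prod_nat.mul
      ((hasSum_twoPsi hk).tendsto_sum_nat.comp
        (tendsto_id.const_mul_atTop' (show 0 < 2 by norm_num)))
  have h₂ : Tendsto (fun n => (∏ i ∈ Finset.range n, (1 - (X ^ k : PowerSeries ℤ) ^ (2 * i + 1))) *
      ∑ j ∈ Finset.range (2 * n), 2 * (X ^ k : PowerSeries ℤ) ^ tri j) atTop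
      (𝓝 (2 * f (2 * k))) := by
    rw [← sub_add_cancel (2 * f (2 * k)) (2 * f (2 * k)), sub_self]
    have hf := (hasProd_f (mul_ne_zero two_ne_zero hk)).tendsto_prod_nat.const_mul 2
    refine ((tendsto_zero_of_X_pow_dvd fun n => ?_).add hf).congr fun n =>
      sub_add_cancel _ (2 * ∏ i ∈ Finset.range n, (1 - (X ^ (2 * k) : PowerSeries ℤ) ^ (i + 1)))
    rw [← Finset.mul_sum, mul_left_comm, prod_mul_sum_pow_tri, ← mul_sub]
    apply Dvd.dvd.mul_left
    rcases n with _ | n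
    · simp
    -- The term s = 0 is the partial product of f (2k); every other term is divisible by X^n.
    rw [Finset.sum_range_succ']
    have : ∏ i ∈ Finset.Ico 0 (n + 1), (1 - (X ^ k : PowerSeries ℤ) ^ (2 * i + 2)) =
        ∏ i ∈ Finset.range (n + 1), (1 - (X ^ (2 * k) : PowerSeries ℤ) ^ (i + 1)) := by
      rw [Nat.Ico_zero_eq_range]
      exact Finset.prod_congr rfl fun i _ => by ring
    simp only [this, Finset.range_zero, Finset.prod_empty, mul_one, zero_mul, pow_zero,
      add_sub_cancel_right]
    refine Finset.dvd_sum fun s _ => Dvd.dvd.mul_left ?_ _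
    rw [← pow_mul]
    refine pow_dvd_pow _ ?_
    have := Nat.pos_of_ne_zero hk
    nlinarith [Nat.mul_le_mul this (show 2 * (n + 1) + 1 ≤ (s + 1) * (2 * (n + 1) + 1) by nlinarith)]
  have h := tendsto_nhds_unique h₁ h₂
  rw [← tprod_one_sub_odd_mul_f hk]
  linear_combination f (2 * k) * h

theorem phiNeg_mul_f {k : ℕ} (hk : k ≠ 0) : phiNeg k * f (2 * k) = f k ^ 2 := by
  have h₁ := (multipliable_one_add hk).hasProd.tendsto_prod_nat.mul (tendsto_phiNeg hk)
  have h₂ : Tendsto (fun n => (∏ i ∈ Finset.range n, (1 + (X ^ k : PowerSeries ℤ) ^ (i + 1))) *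
      (1 + 2 * ∑ j ∈ Finset.range n, (-1) ^ (j + 1) * (X ^ k : PowerSeries ℤ) ^ ((j + 1) ^ 2)))
      atTop (𝓝 (f k)) := by
    rw [← add_zero (f k)]
    simp only [prod_mul_sum_pow_sq]
    refine (hasProd_f hk).tendsto_prod_nat.add (tendsto_zero_of_X_pow_dvd fun n => ?_)
    refine Finset.dvd_sum fun s _ => Dvd.dvd.mul_left ?_ _
    rw [← pow_mul]
    refine pow_dvd_pow _ ?_
    have := Nat.pos_of_ne_zero hk
    nlinarith [Nat.mul_le_mul this (show n + 1 ≤ (s + 1) * (n + 1) by nlinarith)]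
  have h := tendsto_nhds_unique h₁ h₂
  rw [← tprod_one_add_mul_f hk]
  linear_combination f k * h

/-! ### The 2-dissection and the Hecke recursion -/

theorem f_pow_four {k : ℕ} (hk : k ≠ 0) :
    f k ^ 4 = f (2 * k) ^ 2 * (phi (2 * k) ^ 2 - X ^ k * twoPsi (4 * k) ^ 2) := by
  rw [← phiNeg_sq hk]
  linear_combination (-phiNeg k * f (2 * k) - f k ^ 2) * phiNeg_mul_f hk

/-- The even part of the product `f₁⁴ f₅⁴`, in terms of `q²`. -/
noncomputable def evenPart : PowerSeries ℤ :=
  f 1 ^ 2 * f 5 ^ 2 * (phi 1 ^ 2 * phi 5 ^ 2 + X ^ 3 * twoPsi 2 ^ 2 * twoPsi 10 ^ 2)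

/-- Write A² + B² = (A - B)² + 2AB with A = `twoPsi 2 * phi 5` and B = `X * phi 1 * twoPsi 10`; `k₁`
and `k₂` evaluate AB. -/
theorem oddPart_eq :
    f 1 ^ 2 * f 5 ^ 2 * (twoPsi 2 ^ 2 * phi 5 ^ 2 + X ^ 2 * phi 1 ^ 2 * twoPsi 10 ^ 2) =
      4 * (f 1 ^ 4 * f 5 ^ 4) + 8 * (X * (f 2 ^ 4 * f 10 ^ 4)) := by
  have h5 : (5 : ℕ) ≠ 0 := by norm_num
  have e₁ := twoPsi_sq one_ne_zero
  have e₂ := twoPsi_sq h5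
  have g₁ := f_mul_twoPsi one_ne_zero
  have g₂ := f_mul_twoPsi h5
  norm_num at e₁ e₂ g₁ g₂
  have h := two_mul_f_one_mul_f_five
  have h2 : (2 : PowerSeries ℤ) ≠ 0 := fun h0 => by
    have := congrArg (coeff 0) h0
    rw [show (2 : PowerSeries ℤ) = C 2 by simp, coeff_C] at this
    simp at this
  have k₁ : f 1 ^ 2 * (phi 1 * twoPsi 2) = 2 * f 2 ^ 4 := by
    apply mul_left_cancel₀ h2
    linear_combination (f 1 * twoPsi 1 + 2 * f 2 ^ 2) * g₁ - f 1 ^ 2 * e₁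
  have k₂ : f 5 ^ 2 * (phi 5 * twoPsi 10) = 2 * f 10 ^ 4 := by
    apply mul_left_cancel₀ h2
    linear_combination (f 5 * twoPsi 5 + 2 * f 10 ^ 2) * g₂ - f 5 ^ 2 * e₂
  linear_combination (-f 1 ^ 2 * f 5 ^ 2 * (2 * (f 1 * f 5) +
    (twoPsi 2 * phi 5 - X * phi 1 * twoPsi 10))) * h +
    2 * X * (f 5 ^ 2 * (phi 5 * twoPsi 10)) * k₁ + 4 * X * f 2 ^ 4 * k₂

theorem dissection : f 1 ^ 4 * f 5 ^ 4 = expand 2 two_ne_zero evenPart -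
    X * expand 2 two_ne_zero (4 * (f 1 ^ 4 * f 5 ^ 4) + 8 * (X * (f 2 ^ 4 * f 10 ^ 4))) := by
  rw [← oddPart_eq, evenPart, f_pow_four one_ne_zero, f_pow_four (k := 5) (by norm_num)]
  simp only [map_mul, map_add, map_pow, expand_X]
  rw [expand_f, expand_f, expand_phi, expand_phi, expand_twoPsi, expand_twoPsi]
  · norm_num
    ring
  all_goals norm_num

theorem coeff_X_mul_expand_two (p : PowerSeries ℤ) (n : ℕ) :
    coeff (2 * n + 1) (X * expand 2 two_ne_zero p) = coeff n p := by
  rw [coeff_succ_X_mul, coeff_expand_mul]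

/-- The Hecke relation at `2`. -/
theorem Pstar_odd (n : ℕ) : Pstar (2 * n + 1) =
    -(4 * Pstar n) - 8 * coeff n (X * expand 2 two_ne_zero (f 1 ^ 4 * f 5 ^ 4)) := by
  have h := congrArg (coeff (2 * n + 1)) dissection
  rw [map_sub, coeff_X_mul_expand_two, coeff_expand_of_not_dvd _ _ _ (by omega), map_add] at h
  have h4 : (4 : PowerSeries ℤ) = C 4 := by simp
  have h8 : (8 : PowerSeries ℤ) = C 8 := by simp
  rw [h4, h8, coeff_C_mul, coeff_C_mul] at h
  simp only [map_mul, map_pow]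
  rw [expand_f one_ne_zero, expand_f (by norm_num)]
  rw [Pstar, Pstar, h]
  norm_num
  ring

theorem pow_dvd_Pstar (α n : ℕ) :
    (2 : ℤ) ^ (α + 2) ∣ Pstar (2 ^ (α + 1) * n + 2 ^ (α + 1) - 1) := by
  induction α using Nat.twoStepInduction with
  | zero =>
    rw [show 2 ^ (0 + 1) * n + 2 ^ (0 + 1) - 1 = 2 * n + 1 by omega, Pstar_odd]
    omega
  | one =>
    rw [show 2 ^ (1 + 1) * n + 2 ^ (1 + 1) - 1 = 2 * (2 * n + 1) + 1 by omega, Pstar_odd, Pstar_odd]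
    omega
  | more α h₁ h₂ =>
    have hidx : ∀ a, 2 ^ (a + 1 + 1) * n + 2 ^ (a + 1 + 1) - 1 =
        2 * (2 ^ (a + 1) * n + 2 ^ (a + 1) - 1) + 1 := fun a => by
      have hpos : 0 < 2 ^ (a + 1) := by positivity
      rw [pow_succ' 2 (a + 1), mul_assoc]
      omega
    rw [hidx (α + 1), Pstar_odd]
    apply dvd_sub
    · rw [dvd_neg, pow_succ', show (4 : ℤ) = 2 * 2 by norm_num, mul_assoc]
      exact mul_dvd_mul_left 2 (h₂.mul_left 2)
    -- The index is odd again, so this coefficient is the value of `Pstar` two levels down.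
    · rw [hidx α, coeff_X_mul_expand_two, ← Pstar,
        show (2 : ℤ) ^ (α + 2 + 2) = 4 * 2 ^ (α + 2) by ring]
      exact mul_dvd_mul (by norm_num) h₁

end ColorPartition

theorem mainTheorem3 (n α : ℕ) (hα : 1 ≤ α) :
    ColorPartition.Pstar (2 ^ α * n + 2 ^ α - 1) ≡ 0 [ZMOD 2 ^ (α + 1)] := by
  obtain ⟨β, rfl⟩ := Nat.exists_eq_add_of_le' hα
  exact Int.modEq_zero_iff_dvd.mpr (ColorPartition.pow_dvd_Pstar β n)
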